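/- Let $H\subseteq \mathrm{GL}_2(\mathbb{Z}_2)$ be an open subgroup with $-I\notin H$. For $k$ with $\Gamma(2^k)\subseteq H$ let $X_H=X(2^k)/H(2^k)$ be the modular curve over $\mathbb{Q}$ that classifies elliptic curves $E$ with $H$-level structure, i.e. with a Galois-stable $H(2^k)$-orbit of isomorphisms $\iota\colon(\mathbb{Z}/2^k)^2\cong E[2^k]$, where $H(2^k)$ is the image of $H$ in $\mathrm{GL}_2(\mathbb{Z}/2^k)$, acting on row vectors from the right. Assume that (the coarse space of) $X_H$ is isomorphic to $\mathbb{P}^1_{\mathbb{Q}}$, with coordinate $t$, and let $E_H\to U$ be the universal elliptic curve over the open subset $U\subset X_H$ where $j\neq 0,1728,\infty$, regarded (through its generic fibre) as an elliptic curve over $\mathbb{Q}(t)$. Let $A(t),B(t)\in\mathbb{Z}[t]$, let $E_t\colon y^2=x^3+A(t)x+B(t)$, and let $D(t)=-16\,(4A(t)^3+27B(t)^2)$ be its discriminant. Let $F(t)\in\mathbb{Z}[t]$ be squarefree, in the sense that $F=g^2h$ with $g,h\in\mathbb{Z}[t]$ implies $g=\pm1$, and suppose that $E_H$ is isomorphic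 over $\mathbb{Q}(t)$ to the twist $y^2=x^3+A(t)F(t)^2x+B(t)F(t)^3$ of $E_t$ by $F(t)$. Then $F(t)$ divides $D(t)$ in $\mathbb{Q}[t]$. -/

import Mathlib

open Polynomial Matrix

noncomputable section

/-! ### Level structures on elliptic curves and the universal curve over a modular curve -/

namespace ModularTwist

/-- The geometric points `W(K̄)` of a Weierstrass curve over a field `K`. -/
abbrev GeomPoint {K : Type} [Field K] (W : WeierstrassCurve K) : Type :=
  (W.baseChange (AlgebraicClosure K)).toAffine.Point

open scoped Classical in
/-- The geometric `N`-torsion `W(K̄)[N]`. -/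
abbrev GeomTorsion {K : Type} [Field K] (W : WeierstrassCurve K) (N : ℕ) :
    AddSubgroup (GeomPoint W) :=
  AddSubgroup.torsionBy (GeomPoint W) (N : ℤ)

open scoped Classical in
/-- The action of the absolute Galois group of `K` on the geometric points of a curve over `K`. -/
def galAct {K : Type} [Field K] (W : WeierstrassCurve K)
    (σ : AlgebraicClosure K ≃ₐ[K] AlgebraicClosure K) : GeomPoint W →+ GeomPoint W :=
  WeierstrassCurve.Affine.Point.map (W' := W) (S := K) σ.toAlgHom

/-- An elliptic curve over a field `K` with an `H`-level structure rational over `K`, for a subgroup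
`H` of `GL₂(ℤ/N)`: the `H`-orbit of an isomorphism `ι : (ℤ/N)² ≃ E(K̄)[N]`, the orbit being stable
under the Galois group of `K`. Here `A ∈ H` acts by `ι ↦ ι ∘ A`, where matrices act on row vectors
from the right, and stability of the orbit means that `σ ∘ ι = ι ∘ A` with some `A ∈ H`, for each
`σ`; that is, the image of the mod `N` Galois representation in the basis `ι(e₁), ι(e₂)` lies in
`H`. The structure records a representative `ι`; the choice inside the orbit is immaterial
because `IsPullback` only compares orbits. -/
structure LevelCurve {N : ℕ} (H : Subgroup (GL (Fin 2) (ZMod N))) (K : Type) [Field K] where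
  /-- the curve -/
  E : WeierstrassCurve K
  /-- it is nonsingular -/
  isElliptic : E.IsElliptic
  /-- a representative of the level structure -/
  ι : (Fin 2 → ZMod N) ≃+ GeomTorsion E N
  /-- the level structure is rational over `K` -/
  rational : ∀ σ : AlgebraicClosure K ≃ₐ[K] AlgebraicClosure K, ∃ A ∈ H, ∀ v : Fin 2 → ZMod N,
    galAct E σ (ι v) = ι (v ᵥ* (A : Matrix (Fin 2) (Fin 2) (ZMod N)))

attribute [instance] LevelCurve.isElliptic

/-- The points `P ∈ W(L)` and `P' ∈ W'(L')` correspond under the embedding `θ : L → L'` followed by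
the isomorphism given by the change of variables `C`; here `W' = C • W.map θ`, and the coordinates
`(x, y)` on `W` and `(x', y')` on `W'` are related by
`x = u² x' + r`, `y = u³ y' + u² s x' + t`. -/
def PointsCorrespond {L L' : Type} [Field L] [Field L'] {W : WeierstrassCurve L}
    {W' : WeierstrassCurve L'} (θ : L →+* L') (C : WeierstrassCurve.VariableChange L') :
    W.toAffine.Point → W'.toAffine.Point → Prop
  | .zero, .zero => True
  | .some x y _, .some x' y' _ =>
      θ x = (C.u : L') ^ 2 * x' + C.r ∧
      θ y = (C.u : L') ^ 3 * y' + (C.u : L') ^ 2 * C.s * x' + C.t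
  | _, _ => False

/-- `Y`, over `K'`, is isomorphic over `K'` to the pullback of `X`, over `K`, along the embedding
`x : K → K'`. The isomorphism `C` of curves has to carry the pulled back `H`-orbit of `X` to that of
`Y`. To pull back geometric points one extends `x` to an embedding `θ` of the algebraic closures;
which `θ` is taken does not matter, since the level structures are rational. -/
def IsPullback {N : ℕ} {H : Subgroup (GL (Fin 2) (ZMod N))} {K K' : Type} [Field K] [Field K']
    (x : K →+* K') (X : LevelCurve H K) (Y : LevelCurve H K') : Prop :=
  ∃ C : WeierstrassCurve.VariableChange K', C • X.E.map x = Y.E ∧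
    ∃ θ : AlgebraicClosure K →+* AlgebraicClosure K',
      θ.comp (algebraMap K (AlgebraicClosure K)) =
        (algebraMap K' (AlgebraicClosure K')).comp x ∧
      ∃ A ∈ H, ∀ v : Fin 2 → ZMod N,
        PointsCorrespond θ (C.map (algebraMap K' (AlgebraicClosure K')))
          (X.ι v : GeomPoint X.E)
          (Y.ι (v ᵥ* (A : Matrix (Fin 2) (Fin 2) (ZMod N))) : GeomPoint Y.E)

/-- Reduction `GL₂(ℤ₂) → GL₂(ℤ/2ᵏ)`. Its kernel is `Γ(2ᵏ)`. -/
def reduction (k : ℕ) : GL (Fin 2) ℤ_[2] →* GL (Fin 2) (ZMod (2 ^ k)) :=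
  Matrix.GeneralLinearGroup.map (PadicInt.toZModPow k)

/-- The modular curve `X_H` is the projective line over `ℚ` with coordinate `t`, and `𝓔` over
`ℚ(t)` is (the generic fibre of) the universal curve `E_H` over it.

Here `H` contains `Γ(2ᵏ)` for some `k`, and `X_H = X(2ᵏ)/H` is the moduli space of elliptic curves
with `H(2ᵏ)`-level structure, `H(2ᵏ)` being the image of `H`. The universal curve lives over the
open subset `U` of `X_H` where `j ≠ 0, 1728, ∞`. As `U` is a regular curve, an elliptic curve over
it is determined, together with the level structure, by the restriction to the generic point
`Spec ℚ(t)` of `U`, and this is what `X` stands for. The points of `U` with values in a field `K`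
which lie over the generic point of the `j`-line, that is, those with `j` transcendental over `ℚ`,
are the embeddings `x : ℚ(t) → K`. The universal property says that `x ↦ x^* X` is a bijection from
these to the isomorphism classes of elliptic curves over `K` with `H`-level structure and
transcendental `j`-invariant. -/
def IsUniversalCurve (H : Subgroup (GL (Fin 2) ℤ_[2])) (𝓔 : WeierstrassCurve (RatFunc ℚ)) : Prop :=
  ∃ k : ℕ, (reduction k).ker ≤ H ∧
    ∃ X : LevelCurve (H.map (reduction k)) (RatFunc ℚ), X.E = 𝓔 ∧
      Transcendental ℚ X.E.j ∧
      ∀ (K : Type) [Field K] [CharZero K] (Y : LevelCurve (H.map (reduction k)) K),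
        Transcendental ℚ Y.E.j → ∃! x : RatFunc ℚ →+* K, IsPullback x X Y

/-- The Weierstrass curve `y² = x³ + a x + b`. -/
def shortCurve {R : Type} [CommRing R] (a b : R) : WeierstrassCurve R := ⟨0, 0, 0, a, b⟩

/-- The twist `y² = x³ + a d² x + b d³` of `y² = x³ + a x + b` by `d`. -/
def shortTwist {R : Type} [CommRing R] (a b d : R) : WeierstrassCurve R :=
  shortCurve (a * d ^ 2) (b * d ^ 3)

/-- The inclusion of `ℤ[t]` into `ℚ(t)`. -/
def toRatFunc : ℤ[X] →+* RatFunc ℚ :=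
  (algebraMap ℚ[X] (RatFunc ℚ)).comp (Polynomial.mapRingHom (Int.castRingHom ℚ))

end ModularTwist

end

/-! Since `F` stays squarefree over `ℚ`, it suffices that each root `a` of `F` in `ℚ̄` is a root of
`D`. Such an `a` is a simple root. Suppose `D(a) ≠ 0` and expand everything in Laurent series in `t
- a` over `ℚ̄`. There `E_t` has good reduction, so its `2`-power torsion is unramified, hence
rational because the residue field is algebraically closed. The twist is by `F`, of valuation one,
so an automorphism `τ` with `τ √F = -√F` acts as `-1` on the `2`-power torsion of `E_H`. Restricting
`τ` to the algebraic closure of `ℚ(t)` and reading its action through the level structure gives `-I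
∈ H`, a contradiction.

Rationality of the torsion is shown by explicit halving of points instead of reduction theory:
`coords_mem_range_of_two_pow_torsion` is the induction, `isSquare_sub_of_prod` its local input.
`exists_galAct_eq_neg` produces the automorphism, `neg_one_mem_of_galAct_eq_neg` the contradiction.
-/

namespace ModularTwist

/-! ### Halving points of 2-power order. -/

section Doubling

variable {M : Type*} [Field M]

/-- The duplication formula, for a curve `ψ² = 4 (x - e₁) (x - e₂) (x - e₃)`, where
`ψ = y - negY x y`. -/
lemma addX_self_sub [DecidableEq M] [CharZero M] {W : WeierstrassCurve M} {e₁ e₂ e₃ x y : M}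
    (h₂ : W.b₂ = -4 * (e₁ + e₂ + e₃)) (h₄ : W.b₄ = 2 * (e₁ * e₂ + e₁ * e₃ + e₂ * e₃))
    (h₆ : W.b₆ = -4 * (e₁ * e₂ * e₃)) (h : W.toAffine.Equation x y)
    (hy : y ≠ W.toAffine.negY x y) :
    W.toAffine.addX x x (W.toAffine.slope x x y y) - e₁ =
      (((x - e₁) ^ 2 - (e₁ - e₂) * (e₁ - e₃)) / (y - W.toAffine.negY x y)) ^ 2 := by
  have hψ : y - W.toAffine.negY x y ≠ 0 := sub_ne_zero.mpr hy
  rw [WeierstrassCurve.Affine.slope_of_Y_ne rfl hy]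
  rw [WeierstrassCurve.Affine.equation_iff] at h
  simp only [WeierstrassCurve.Affine.addX, WeierstrassCurve.b₂, WeierstrassCurve.b₄,
    WeierstrassCurve.b₆, WeierstrassCurve.Affine.negY] at *
  obtain ⟨a₁, a₂, a₃, a₄, a₆⟩ := W
  simp only at *
  -- Completing the square; the coefficients are then eliminated in favour of `a₁`, `a₃` and the
  -- `eᵢ`.
  obtain ⟨ψ, rfl⟩ : ∃ ψ, y = (ψ - a₁ * x - a₃) / 2 := ⟨2 * y + a₁ * x + a₃, by ring⟩
  obtain rfl : a₂ = -(e₁ + e₂ + e₃) - a₁ ^ 2 / 4 := by linear_combination h₂ / 4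
  obtain rfl : a₄ = (e₁ * e₂ + e₁ * e₃ + e₂ * e₃) - a₁ * a₃ / 2 := by linear_combination h₄ / 2
  obtain rfl : a₆ = -(e₁ * e₂ * e₃) - a₃ ^ 2 / 4 := by linear_combination h₆ / 4
  have e : (ψ - a₁ * x - a₃) / 2 - (-((ψ - a₁ * x - a₃) / 2) - a₁ * x - a₃) = ψ := by ring
  rw [e] at hψ ⊢
  have hc : ψ ^ 2 = 4 * ((x - e₁) * (x - e₂) * (x - e₃)) := by linear_combination 4 * h
  field_simp
  linear_combination (64 * (e₂ + e₃ - 2 * x)) * hc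

lemma sq_sub_negY {W : WeierstrassCurve M} {e₁ e₂ e₃ x y : M}
    (h₂ : W.b₂ = -4 * (e₁ + e₂ + e₃)) (h₄ : W.b₄ = 2 * (e₁ * e₂ + e₁ * e₃ + e₂ * e₃))
    (h₆ : W.b₆ = -4 * (e₁ * e₂ * e₃)) (h : W.toAffine.Equation x y) :
    (y - W.toAffine.negY x y) ^ 2 = 4 * ((x - e₁) * (x - e₂) * (x - e₃)) := by
  rw [WeierstrassCurve.Affine.equation_iff] at h
  simp only [WeierstrassCurve.b₂, WeierstrassCurve.b₄,
    WeierstrassCurve.b₆, WeierstrassCurve.Affine.negY] at *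
  linear_combination 4 * h + x ^ 2 * h₂ + 2 * x * h₄ + h₆

/-- Let `ψ² = 4 (x - e₁) (x - e₂) (x - e₃)`, with `eᵢ` in a subfield `L` of `M`, and let `c² ∈ L`.
If the `c² (x - eᵢ)` are squares in `L` as soon as their product is one, then the coordinates `x`
and `c ψ` of all points of `2`-power order lie in `L`. -/
lemma coords_mem_range_of_two_pow_torsion [DecidableEq M] [CharZero M] {L : Type*}
    [Field L] [Algebra L M]
    {W : WeierstrassCurve M} {c : M} {f e₁ e₂ e₃ : L} (hc : c ≠ 0) (hf : c ^ 2 = algebraMap L M f)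
    (he₁₂ : e₁ ≠ e₂) (he₁₃ : e₁ ≠ e₃) (he₂₃ : e₂ ≠ e₃)
    (h₂ : W.b₂ = algebraMap L M (-4 * (e₁ + e₂ + e₃)))
    (h₄ : W.b₄ = algebraMap L M (2 * (e₁ * e₂ + e₁ * e₃ + e₂ * e₃)))
    (h₆ : W.b₆ = algebraMap L M (-4 * (e₁ * e₂ * e₃)))
    (hsq : ∀ x y : L, f * ((x - e₁) * (x - e₂) * (x - e₃)) = y ^ 2 →
      IsSquare (f * (x - e₁)) ∧ IsSquare (f * (x - e₂)) ∧ IsSquare (f * (x - e₃)))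
    (n : ℕ) {x y : M} (h : W.toAffine.Nonsingular x y)
    (hP : 2 ^ n • WeierstrassCurve.Affine.Point.some x y h = 0) :
    x ∈ (algebraMap L M).range ∧ c * (y - W.toAffine.negY x y) ∈ (algebraMap L M).range := by
  simp only [map_mul, map_add, map_neg, map_ofNat] at h₂ h₄ h₆
  induction n generalizing x y with
  | zero => simp at hP
  | succ n ih =>
    -- Either the point is 2-torsion and `x` is some `eᵢ`, or its double is an affine point to which
    -- `ih` applies.
    by_cases hy : y = W.toAffine.negY x y
    · have := sq_sub_negY h₂ h₄ h₆ h.1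
      rw [sub_eq_zero.mpr hy] at this ⊢
      refine ⟨?_, by simp⟩
      have : ((x - algebraMap L M e₁) * (x - algebraMap L M e₂)) * (x - algebraMap L M e₃) = 0 := by
        linear_combination -this / 4
      rcases mul_eq_zero.mp this with this | this
      · rcases mul_eq_zero.mp this with this | this
        · exact ⟨_, (sub_eq_zero.mp this).symm⟩
        · exact ⟨_, (sub_eq_zero.mp this).symm⟩
      · exact ⟨_, (sub_eq_zero.mp this).symm⟩
    · rw [pow_succ, mul_smul, two_smul, WeierstrassCurve.Affine.Point.add_self_of_Y_ne hy] at hP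
      obtain ⟨⟨q, hq⟩, ⟨w, hw⟩⟩ := ih _ hP
      have hns := WeierstrassCurve.Affine.nonsingular_add h h fun hxy => hy hxy.right
      have hcurve := sq_sub_negY h₂ h₄ h₆ hns.1
      have d₁ := addX_self_sub h₂ h₄ h₆ h.1 hy
      have d₂ := addX_self_sub (e₁ := algebraMap L M e₂) (e₂ := algebraMap L M e₁)
        (e₃ := algebraMap L M e₃) (by rw [h₂]; ring) (by rw [h₄]; ring) (by rw [h₆]; ring) h.1 hy
      have d₃ := addX_self_sub (e₁ := algebraMap L M e₃) (e₂ := algebraMap L M e₁)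
        (e₃ := algebraMap L M e₂) (by rw [h₂]; ring) (by rw [h₄]; ring) (by rw [h₆]; ring) h.1 hy
      have hψ : y - W.toAffine.negY x y ≠ 0 := sub_ne_zero.mpr hy
      rw [← hq] at d₁ d₂ d₃
      generalize y - W.toAffine.negY x y = ψ at *
      have hfac : f * ((q - e₁) * (q - e₂) * (q - e₃)) = (w / 2) ^ 2 := by
        apply (algebraMap L M).injective
        simp only [map_mul, map_sub, map_pow, map_div₀, map_ofNat, ← hf, hw, div_pow, mul_pow,
          hcurve, hq]
        ring
      obtain ⟨s₁, s₂, s₃⟩ := hsq _ _ hfac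
      have lift : ∀ {e : L} {z : M}, IsSquare (f * (q - e)) →
          algebraMap L M q - algebraMap L M e = z ^ 2 → c * z ∈ (algebraMap L M).range := by
        rintro e z ⟨r, hr⟩ hz
        have : (c * z) ^ 2 = algebraMap L M r ^ 2 := by
          rw [mul_pow, hf, ← hz, ← map_sub, ← map_mul, hr, map_mul, sq]
        rcases sq_eq_sq_iff_eq_or_eq_neg.mp this with h | h
        · exact ⟨r, h.symm⟩
        · exact ⟨-r, by rw [h, map_neg]⟩
      obtain ⟨w₁, hw₁⟩ := lift s₁ d₁
      obtain ⟨w₂, hw₂⟩ := lift s₂ d₂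
      obtain ⟨w₃, hw₃⟩ := lift s₃ d₃
      have i : ∀ {a b : L}, a ≠ b → algebraMap L M a - algebraMap L M b ≠ 0 := fun hab =>
        sub_ne_zero.mpr ((algebraMap L M).injective.ne hab)
      have hf0 : algebraMap L M f ≠ 0 := hf ▸ pow_ne_zero 2 hc
      -- With `zᵢ` the square root of `q - eᵢ` given by the duplication formula, `z₃ - z₂ = 2 (e₂ -
      -- e₃) (x - e₁) / ψ`, and `wᵢ` maps to `c zᵢ`.
      have u₁ : (x - algebraMap L M e₁) / (c * ψ) =
          algebraMap L M ((w₃ - w₂) / (2 * f * (e₂ - e₃))) := by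
        have := i he₂₃
        simp only [map_div₀, map_sub, map_mul, map_ofNat, hw₂, hw₃, ← hf]
        field_simp
        ring
      have u₃ : (x - algebraMap L M e₃) / (c * ψ) =
          algebraMap L M ((w₂ - w₁) / (2 * f * (e₁ - e₂))) := by
        have := i he₁₂
        simp only [map_div₀, map_sub, map_mul, map_ofNat, hw₁, hw₂, ← hf]
        field_simp
        ring
      generalize (w₃ - w₂) / (2 * f * (e₂ - e₃)) = p at u₁
      generalize (w₂ - w₁) / (2 * f * (e₁ - e₂)) = r at u₃
      -- Subtracting the two quotients eliminates `x` and determines `c ψ`.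
      have hpr : algebraMap L M (p - r) * (c * ψ) = algebraMap L M (e₃ - e₁) := by
        rw [map_sub, ← u₁, ← u₃, map_sub]
        field_simp
        ring
      have hpr0 : p - r ≠ 0 := by
        intro h0
        rw [h0, map_zero, zero_mul, map_sub] at hpr
        exact i he₁₃.symm hpr.symm
      have hpr0' : algebraMap L M (p - r) ≠ 0 := by
        rwa [Ne, map_eq_zero]
      have hcψ : c * ψ = algebraMap L M ((e₃ - e₁) / (p - r)) := by
        rw [map_div₀, ← hpr]
        field_simp
      refine ⟨⟨e₁ + p * ((e₃ - e₁) / (p - r)), ?_⟩, ⟨_, hcψ.symm⟩⟩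
      rw [map_add, map_mul, ← hcψ, ← u₁]
      field_simp
      ring

end Doubling

/-! ### Squares and roots of cubics over power series. -/

/-- Over a valuation ring whose units are squares, if the `eᵢ` are distinct modulo the maximal ideal
and `(x - e₁) (x - e₂) (x - e₃)` is a square then so is `x - e₁`. -/
lemma isSquare_sub_of_prod {O L : Type*} [CommRing O] [IsDomain O] [ValuationRing O] [Field L]
    [Algebra O L] [IsFractionRing O L] (hO : ∀ u : O, IsUnit u → IsSquare u) {e₁ e₂ e₃ : O}
    (h₁₂ : IsUnit (e₁ - e₂)) (h₁₃ : IsUnit (e₁ - e₃)) {x y : L}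
    (h : (x - algebraMap O L e₁) * (x - algebraMap O L e₂) * (x - algebraMap O L e₃) = y ^ 2) :
    IsSquare (x - algebraMap O L e₁) := by
  have sq : ∀ u : O, IsUnit u → ∃ r : L, r ≠ 0 ∧ algebraMap O L u = r ^ 2 := by
    intro u hu
    obtain ⟨r, rfl⟩ := hO u hu
    have : algebraMap O L (r * r) ≠ 0 := (hu.map (algebraMap O L)).ne_zero
    refine ⟨algebraMap O L r, fun h0 => this (by rw [map_mul, h0, zero_mul]), by rw [map_mul, sq]⟩
  have of_isInteger : ∀ a : O, x = algebraMap O L a → IsSquare (x - algebraMap O L e₁) := by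
    rintro a rfl
    by_cases hu : IsUnit (a - e₁)
    · obtain ⟨r, -, hr⟩ := sq _ hu
      exact ⟨r, by rw [← map_sub, hr, _root_.sq]⟩
    -- At most one factor is a nonunit; the other two are squares, hence so is this one.
    · have key : ∀ e : O, IsUnit (e₁ - e) → IsUnit (a - e) := fun e he => by
        by_contra hn
        have := IsLocalRing.nonunits_add hn (b := -(a - e₁)) (by rwa [mem_nonunits_iff, IsUnit.neg_iff])
        exact this (by convert he using 1; ring)
      obtain ⟨r₂, h₂, hr₂⟩ := sq _ (key e₂ h₁₂)
      obtain ⟨r₃, h₃, hr₃⟩ := sq _ (key e₃ h₁₃)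
      refine ⟨y / (r₂ * r₃), ?_⟩
      simp only [map_sub] at hr₂ hr₃
      rw [hr₂, hr₃] at h
      field_simp
      linear_combination h
  rcases ValuationRing.isInteger_or_isInteger O x with ⟨a, ha⟩ | ⟨m, hm⟩
  · exact of_isInteger a ha.symm
  · by_cases hx : x = 0
    · exact of_isInteger 0 (by simp [hx])
    by_cases hu : IsUnit m
    · obtain ⟨u, rfl⟩ := hu
      refine of_isInteger (↑u⁻¹) ?_
      rw [← inv_inv x, ← hm]
      exact inv_eq_of_mul_eq_one_right (by rw [← map_mul, Units.mul_inv, map_one])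
    -- Now `x` has a pole: each factor is `x` times a unit, so the product is `x³` times a square.
    · have key : ∀ e : O, ∃ r : L, r ≠ 0 ∧ x - algebraMap O L e = x * r ^ 2 := fun e => by
        obtain ⟨r, h0, hr⟩ := sq (1 - m * e) <| by
          by_contra hn
          have := IsLocalRing.nonunits_add hn (b := m * e) (fun h => hu (isUnit_of_mul_isUnit_left h))
          simp at this
        refine ⟨r, h0, ?_⟩
        rw [← hr, map_sub, map_mul, hm, map_one]
        field_simp
      obtain ⟨r₁, h₁, hr₁⟩ := key e₁
      obtain ⟨r₂, h₂, hr₂⟩ := key e₂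
      obtain ⟨r₃, h₃, hr₃⟩ := key e₃
      refine ⟨y / (x * r₂ * r₃), ?_⟩
      rw [hr₁, hr₂, hr₃] at h
      rw [hr₁]
      field_simp
      linear_combination h

section PowerSeries

variable {k : Type*} [Field k]

/-- Hensel's lemma for the ideal `(X)`. -/
lemma PowerSeries.exists_root_of_simple {f : (PowerSeries k)[X]} (hf : f.Monic) (a₀ : k)
    (h₀ : (f.map PowerSeries.constantCoeff).eval a₀ = 0)
    (h₁ : (f.map PowerSeries.constantCoeff).derivative.eval a₀ ≠ 0) :
    ∃ a : PowerSeries k, f.eval a = 0 ∧ PowerSeries.constantCoeff a = a₀ := by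
  have key : ∀ g : (PowerSeries k)[X], PowerSeries.constantCoeff (g.eval (PowerSeries.C a₀)) =
      (g.map PowerSeries.constantCoeff).eval a₀ := fun g => by
    rw [← Polynomial.eval_map_apply]; simp
  obtain ⟨a, ha, hmem⟩ := HenselianRing.is_henselian (I := Ideal.span {(PowerSeries.X : PowerSeries k)})
    f hf (PowerSeries.C a₀)
    (by rw [Ideal.mem_span_singleton, PowerSeries.X_dvd_iff, key, h₀])
    (by
      refine IsUnit.map _ (PowerSeries.isUnit_iff_constantCoeff.mpr ?_)
      rw [key, ← Polynomial.derivative_map]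
      exact h₁.isUnit)
  refine ⟨a, ha, ?_⟩
  rw [Ideal.mem_span_singleton, PowerSeries.X_dvd_iff] at hmem
  simpa [sub_eq_zero] using hmem

variable [IsAlgClosed k] [CharZero k]

lemma PowerSeries.isSquare_of_isUnit {u : PowerSeries k} (hu : IsUnit u) : IsSquare u := by
  obtain ⟨r, hr⟩ := IsAlgClosed.exists_pow_nat_eq (PowerSeries.constantCoeff u) two_pos
  have hu0 := (PowerSeries.isUnit_iff_constantCoeff.mp hu).ne_zero
  have hr0 : r ≠ 0 := by rintro rfl; simp at hr; exact hu0 hr.symm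
  obtain ⟨a, ha, -⟩ := PowerSeries.exists_root_of_simple (f := X ^ 2 - C u)
    (monic_X_pow_sub_C u two_ne_zero) r (by simp [hr]) (by simpa using hr0)
  exact ⟨a, by simp [sub_eq_zero] at ha; rw [← ha, sq]⟩

/-- A cubic `x³ + a x + b` with unit discriminant over `k⟦X⟧` splits. -/
lemma PowerSeries.exists_roots_cubic {a b : PowerSeries k}
    (h : IsUnit (4 * a ^ 3 + 27 * b ^ 2)) :
    ∃ e₁ e₂ e₃ : PowerSeries k, e₁ + e₂ + e₃ = 0 ∧ e₁ * e₂ + e₁ * e₃ + e₂ * e₃ = a ∧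
      e₁ * e₂ * e₃ = -b ∧ IsUnit (e₁ - e₂) ∧ IsUnit (e₁ - e₃) ∧ IsUnit (e₂ - e₃) := by
  have hm : (X ^ 3 + C a * X + C b).Monic := by monicity!
  have hd : ((X ^ 3 + C a * X + C b).map (PowerSeries.constantCoeff (R := k))).degree ≠ 0 := by
    rw [hm.degree_map]
    have : (X ^ 3 + C a * X + C b).degree = 3 := by compute_degree!
    rw [this]; decide
  obtain ⟨r, hr⟩ := IsAlgClosed.exists_root _ hd
  have hr' : r ^ 3 + PowerSeries.constantCoeff a * r + PowerSeries.constantCoeff b = 0 := by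
    simpa using hr
  have h' := (PowerSeries.isUnit_iff_constantCoeff.mp h).ne_zero
  simp only [map_add, map_mul, map_pow, map_ofNat] at h'
  -- A multiple root modulo `X` would annihilate the discriminant.
  obtain ⟨e, he, -⟩ := PowerSeries.exists_root_of_simple hm r hr <| by
    intro h0
    apply h'
    simp at h0
    obtain hb : PowerSeries.constantCoeff b = -(r ^ 3 + PowerSeries.constantCoeff a * r) := by
      linear_combination hr'
    rw [hb]
    linear_combination ((3 * r ^ 2 + PowerSeries.constantCoeff a) *
      (3 * r ^ 2 + 4 * PowerSeries.constantCoeff a)) * h0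
  simp at he
  obtain rfl : b = -(e ^ 3 + a * e) := by linear_combination he
  have hfac : 4 * a ^ 3 + 27 * (-(e ^ 3 + a * e)) ^ 2 =
      (3 * e ^ 2 + a) ^ 2 * (3 * e ^ 2 + 4 * a) := by ring
  rw [hfac, IsUnit.mul_iff, isUnit_pow_iff two_ne_zero] at h
  -- The cofactor `x² + e x + e² + a` has discriminant `-(3 e² + 4 a)`, a unit and so a square `d²`;
  -- the other roots are `(±d - e) / 2`.
  obtain ⟨d, hd⟩ := PowerSeries.isSquare_of_isUnit h.2.neg
  have hdu : IsUnit d := isUnit_of_mul_isUnit_left (hd ▸ h.2.neg)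
  have h2u : (PowerSeries.C (2⁻¹ : k)) * 2 = 1 := by
    rw [← map_ofNat PowerSeries.C 2, ← map_mul]; simp
  generalize PowerSeries.C (2⁻¹ : k) = t at h2u
  have hprod : 3 * e ^ 2 + a = (e - t * (d - e)) * (e - t * (-d - e)) := by
    linear_combination (-t ^ 2) * hd - (a * (2 * t + 1) + e ^ 2 * (2 * t + 2)) * h2u
  refine ⟨e, t * (d - e), t * (-d - e), ?_, ?_, ?_, ?_, ?_, ?_⟩
  · linear_combination (-e) * h2u
  · linear_combination t ^ 2 * hd + (a * (2 * t + 1) + 2 * t * e ^ 2) * h2u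
  · linear_combination e * t ^ 2 * hd + e * (e ^ 2 + a) * (2 * t + 1) * h2u
  · exact isUnit_of_mul_isUnit_left (hprod ▸ h.1)
  · exact isUnit_of_mul_isUnit_right (hprod ▸ h.1)
  · convert hdu using 1
    linear_combination d * h2u

end PowerSeries

/-! ### Ramified quadratic twists and the Galois action. -/

/-- An element of a discrete valuation ring of valuation one is not a square in the fraction
field. -/
lemma not_isSquare_algebraMap_of_irreducible {O L : Type*} [CommRing O] [IsDomain O]
    [IsIntegrallyClosed O] [Field L] [Algebra O L] [IsFractionRing O L] {f : O}
    (hf : Irreducible f) : ¬ IsSquare (algebraMap O L f) := by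
  rintro ⟨z, hz⟩
  obtain ⟨w, rfl⟩ := IsIntegrallyClosed.exists_algebraMap_eq_of_isIntegral_pow (R := O) (x := z)
    two_pos (by rw [sq, ← hz]; exact isIntegral_algebraMap)
  rw [← map_mul] at hz
  exact hf.not_isSquare ⟨w, IsFractionRing.injective O L hz⟩

lemma exists_algEquiv_neg {L M : Type*} [Field L] [Field M] [Algebra L M] [IsGalois L M]
    {f : L} {c : M} (hc : c ^ 2 = algebraMap L M f) (hf : ¬ IsSquare f) :
    ∃ τ : M ≃ₐ[L] M, τ c = -c := by
  by_contra! hτ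
  have : c ∈ Set.range (algebraMap L M) := by
    rw [InfiniteGalois.mem_range_algebraMap_iff_fixed]
    intro τ
    refine (sq_eq_sq_iff_eq_or_eq_neg.mp ?_).resolve_right (hτ τ)
    rw [← map_pow, hc, AlgEquiv.commutes]
  obtain ⟨z, rfl⟩ := this
  rw [← map_pow] at hc
  exact hf ⟨z, by rw [← sq]; exact ((algebraMap L M).injective hc).symm⟩

/-- `b`-invariants of a curve isomorphic to a twist of a short Weierstrass curve. -/
lemma b_invariants_of_smul_eq_shortTwist {K : Type} [Field K] [CharZero K] {W : WeierstrassCurve K}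
    {C : WeierstrassCurve.VariableChange K} {a b d : K} (h : C • W = shortTwist a b d) :
    W.b₂ = -12 * C.r ∧ W.b₄ = 2 * (3 * C.r ^ 2 + C.u ^ 4 * (a * d ^ 2)) ∧
      W.b₆ = -4 * (C.r ^ 3 + C.u ^ 4 * (a * d ^ 2) * C.r - C.u ^ 6 * (b * d ^ 3)) := by
  have h₂ := congrArg WeierstrassCurve.b₂ h
  have h₄ := congrArg WeierstrassCurve.b₄ h
  have h₆ := congrArg WeierstrassCurve.b₆ h
  rw [WeierstrassCurve.variableChange_b₂] at h₂
  rw [WeierstrassCurve.variableChange_b₄] at h₄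
  rw [WeierstrassCurve.variableChange_b₆] at h₆
  have hu := C.u.ne_zero
  simp only [shortTwist, shortCurve, WeierstrassCurve.b₂, WeierstrassCurve.b₄,
    WeierstrassCurve.b₆, Units.val_inv_eq_inv_val] at h₂ h₄ h₆ ⊢
  field_simp at h₂ h₄ h₆
  have k₂ : W.a₁ ^ 2 + 4 * W.a₂ = -12 * C.r := by linear_combination h₂
  refine ⟨k₂, ?_, ?_⟩
  · linear_combination h₄ - C.r * k₂
  · linear_combination h₆ - 2 * C.r * h₄ + C.r ^ 2 * k₂

section Local

variable {k : Type} [Field k] [IsAlgClosed k] [CharZero k]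

lemma isSquare_twist {L : Type*} [Field L] [Algebra (PowerSeries k) L]
    [IsFractionRing (PowerSeries k) L] {e₁ e₂ e₃ : PowerSeries k} (h₁₂ : IsUnit (e₁ - e₂))
    (h₁₃ : IsUnit (e₁ - e₃)) {u r f x y : L} (hu : u ≠ 0) (hf : f ≠ 0)
    (h : f * ((x - (r + u ^ 2 * f * algebraMap _ L e₁)) * (x - (r + u ^ 2 * f * algebraMap _ L e₂)) *
      (x - (r + u ^ 2 * f * algebraMap _ L e₃))) = y ^ 2) :
    IsSquare (f * (x - (r + u ^ 2 * f * algebraMap _ L e₁))) := by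
  -- Passing to the coordinate of the untwisted curve turns the product into `u⁶ f⁴ ∏ (z - eᵢ)`.
  obtain ⟨z, rfl⟩ : ∃ z, x = r + u ^ 2 * f * z := ⟨(x - r) / (u ^ 2 * f), by field_simp; ring⟩
  obtain ⟨s, hs⟩ := isSquare_sub_of_prod (O := PowerSeries k) (x := z) (y := y / (u ^ 3 * f ^ 2))
    (fun _ => PowerSeries.isSquare_of_isUnit) h₁₂ h₁₃ (by field_simp; linear_combination h)
  exact ⟨u * f * s, by linear_combination (u ^ 2 * f ^ 2) * hs⟩

open scoped Classical in
/-- If `W` over `K` becomes, over `k((X))`, a ramified quadratic twist of a curve with good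
reduction, then some element of the Galois group of `K` acts as `-1` on the `2`-power torsion. -/
theorem exists_galAct_eq_neg {K L : Type} [Field K] [CharZero K] [Field L] [Algebra (PowerSeries k) L]
    [IsFractionRing (PowerSeries k) L] (φ : K →+* L) {W : WeierstrassCurve K}
    {C : WeierstrassCurve.VariableChange K} {a b d : K} (hC : C • W = shortTwist a b d)
    {a' b' d' : PowerSeries k} (ha : φ a = algebraMap _ L a') (hb : φ b = algebraMap _ L b')
    (hd : φ d = algebraMap _ L d') (hΔ : IsUnit (4 * a' ^ 3 + 27 * b' ^ 2))
    (hd' : Irreducible d') :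
    ∃ σ : AlgebraicClosure K ≃ₐ[K] AlgebraicClosure K, ∀ (n : ℕ) (P : GeomPoint W),
      2 ^ n • P = 0 → galAct W σ P = -P := by
  let : Algebra K L := φ.toAlgebra
  have hφ : ∀ x, algebraMap K L x = φ x := fun _ => rfl
  have : CharZero L := charZero_of_injective_ringHom φ.injective
  let M := AlgebraicClosure L
  have : CharZero M := charZero_of_injective_algebraMap (algebraMap L M).injective
  have : IsGalois L M := inferInstance
  let j : AlgebraicClosure K →ₐ[K] M := IsAlgClosed.lift
  let : Algebra (AlgebraicClosure K) M := j.toAlgebra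
  have : IsScalarTower K (AlgebraicClosure K) M := IsScalarTower.of_algHom j
  have hd0 : φ d ≠ 0 := by
    rw [hd, Ne, FaithfulSMul.algebraMap_eq_zero_iff]
    exact hd'.ne_zero
  obtain ⟨c, hc⟩ := IsAlgClosed.exists_pow_nat_eq (algebraMap L M (φ d)) two_pos
  have hc0 : c ≠ 0 := by
    rintro rfl
    rw [zero_pow two_ne_zero] at hc
    exact hd0 ((map_eq_zero _).mp hc.symm)
  obtain ⟨τ, hτ⟩ := exists_algEquiv_neg hc (hd ▸ not_isSquare_algebraMap_of_irreducible hd')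
  obtain ⟨e₁, e₂, e₃, s₁, s₂, s₃, h₁₂, h₁₃, h₂₃⟩ := PowerSeries.exists_roots_cubic hΔ
  have hu : φ C.u ≠ 0 := (map_ne_zero φ).mpr C.u.ne_zero
  let E : PowerSeries k → L := fun e => φ C.r + φ C.u ^ 2 * φ d * algebraMap _ L e
  have hE : ∀ e e', IsUnit (e - e') → E e ≠ E e' := by
    intro e e' he h
    refine he.ne_zero (sub_eq_zero.mpr (IsFractionRing.injective (PowerSeries k) L ?_))
    exact mul_left_cancel₀ (mul_ne_zero (pow_ne_zero 2 hu) hd0) (add_left_cancel h)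
  obtain ⟨t₂, t₄, t₆⟩ := b_invariants_of_smul_eq_shortTwist hC
  replace s₁ := congrArg (algebraMap (PowerSeries k) L) s₁
  replace s₂ := congrArg (algebraMap (PowerSeries k) L) s₂
  replace s₃ := congrArg (algebraMap (PowerSeries k) L) s₃
  simp only [map_add, map_mul, map_zero, map_neg, ← ha, ← hb] at s₁ s₂ s₃
  have key : ∀ (n : ℕ) (x y : M) (h : (W.baseChange M).toAffine.Nonsingular x y),
      2 ^ n • WeierstrassCurve.Affine.Point.some x y h = 0 →
      x ∈ (algebraMap L M).range ∧
        c * (y - (W.baseChange M).toAffine.negY x y) ∈ (algebraMap L M).range := by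
    intro n x y h
    refine coords_mem_range_of_two_pow_torsion (e₁ := E e₁) (e₂ := E e₂) (e₃ := E e₃) hc0 hc
      (hE _ _ h₁₂) (hE _ _ h₁₃) (hE _ _ h₂₃) ?_ ?_ ?_ ?_ n h
    · rw [WeierstrassCurve.baseChange, WeierstrassCurve.map_b₂, t₂, IsScalarTower.algebraMap_apply K L M, hφ]
      congr 1
      simp only [E, map_mul, map_neg, map_ofNat]
      linear_combination 4 * φ C.u ^ 2 * φ d * s₁
    · rw [WeierstrassCurve.baseChange, WeierstrassCurve.map_b₄, t₄, IsScalarTower.algebraMap_apply K L M, hφ]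
      congr 1
      simp only [E, map_mul, map_add, map_pow, map_ofNat]
      linear_combination (-4) * φ C.r * φ C.u ^ 2 * φ d * s₁ - 2 * φ C.u ^ 4 * φ d ^ 2 * s₂
    · rw [WeierstrassCurve.baseChange, WeierstrassCurve.map_b₆, t₆, IsScalarTower.algebraMap_apply K L M, hφ]
      congr 1
      simp only [E, map_mul, map_add, map_sub, map_neg, map_pow, map_ofNat]
      linear_combination 4 * φ C.r ^ 2 * φ C.u ^ 2 * φ d * s₁ +
        4 * φ C.r * φ C.u ^ 4 * φ d ^ 2 * s₂ + 4 * φ C.u ^ 6 * φ d ^ 3 * s₃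
    · intro x y h
      refine ⟨isSquare_twist h₁₂ h₁₃ hu hd0 h,
        isSquare_twist (e₂ := e₁) (e₃ := e₃) (y := y) ?_ h₂₃ hu hd0 ?_,
        isSquare_twist (e₂ := e₁) (e₃ := e₂) (y := y) ?_ ?_ hu hd0 ?_⟩
      · simpa using h₁₂.neg
      · rw [← h]; ring
      · simpa using h₁₃.neg
      · simpa using h₂₃.neg
      · rw [← h]; ring
  -- `τ` fixes `x` and `c ψ` but negates `c`, so it negates `ψ = y - negY`, which sends `y` to
  -- `negY`.
  have hneg : ∀ (n : ℕ) (P : (W.baseChange M).toAffine.Point), 2 ^ n • P = 0 →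
      WeierstrassCurve.Affine.Point.map (W' := W) (S := K) (τ.restrictScalars K).toAlgHom P = -P := by
    rintro n (_ | ⟨x, y, h⟩) hP
    · exact (map_zero _).trans neg_zero.symm
    · obtain ⟨⟨x', rfl⟩, ⟨w, hw⟩⟩ := key n x y h hP
      rw [WeierstrassCurve.Affine.Point.map_some, WeierstrassCurve.Affine.Point.neg_some]
      have hx : (τ.restrictScalars K).toAlgHom (algebraMap L M x') = algebraMap L M x' :=
        τ.commutes x'
      congr 1
      have h₁ : (τ.restrictScalars K).toAlgHom (algebraMap K M W.a₁) = algebraMap K M W.a₁ :=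
        AlgHom.commutes _ _
      have h₃ : (τ.restrictScalars K).toAlgHom (algebraMap K M W.a₃) = algebraMap K M W.a₃ :=
        AlgHom.commutes _ _
      have hw' := congrArg (τ.restrictScalars K).toAlgHom hw
      have hτw : (τ.restrictScalars K).toAlgHom (algebraMap L M w) = algebraMap L M w :=
        τ.commutes w
      have hτc : (τ.restrictScalars K).toAlgHom c = -c := hτ
      rw [hτw, hw] at hw'
      simp only [WeierstrassCurve.Affine.negY, WeierstrassCurve.baseChange,
        WeierstrassCurve.map_a₁, WeierstrassCurve.map_a₃, map_mul, map_sub, map_neg, hx, h₁, h₃,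
        hτc] at hw' ⊢
      apply mul_left_cancel₀ hc0
      linear_combination (1 / 2) * hw'
  refine ⟨(τ.restrictScalars K).restrictNormal (AlgebraicClosure K), fun n P hP => ?_⟩
  apply WeierstrassCurve.Affine.Point.map_injective (W' := W) j
  rw [map_neg, ← hneg n _ (by rw [← map_nsmul, hP, map_zero]), galAct,
    WeierstrassCurve.Affine.Point.map_map, WeierstrassCurve.Affine.Point.map_map]
  congr 2
  ext x
  exact AlgEquiv.restrictNormal_commutes (τ.restrictScalars K) (AlgebraicClosure K) x

end Local

/-! ### Squarefree polynomials and Taylor expansion. -/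

/-- A consequence of Gauss's lemma. -/
lemma squarefree_map_int_cast {F : ℤ[X]} (hF : Squarefree F) :
    Squarefree (F.map (Int.castRingHom ℚ)) := by
  have hF0 := hF.ne_zero
  rw [squarefree_iff_irreducible_sq_not_dvd_of_ne_zero
    ((Polynomial.map_ne_zero_iff (RingHom.injective_int _)).mpr hF0)]
  intro p hp hdvd
  obtain ⟨q, hq, hpq⟩ : ∃ q : ℤ[X], q.IsPrimitive ∧ Associated p (q.map (Int.castRingHom ℚ)) := by
    obtain ⟨b, hb, hbp⟩ := IsLocalization.integerNormalization_spec (nonZeroDivisors ℤ) p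
    set r := IsLocalization.integerNormalization (nonZeroDivisors ℤ) p
    have hb0 : (b : ℚ) ≠ 0 := by exact_mod_cast nonZeroDivisors.ne_zero hb
    have hr0 : r ≠ 0 := by
      intro h
      rw [h, Polynomial.map_zero] at hbp
      exact smul_ne_zero (nonZeroDivisors.ne_zero hb) hp.ne_zero hbp.symm
    have hr : C (r.content : ℚ) * r.primPart.map (Int.castRingHom ℚ) = C (b : ℚ) * p := by
      have := congrArg (Polynomial.map (Int.castRingHom ℚ)) r.eq_C_content_mul_primPart
      rw [Polynomial.map_mul, map_C] at this
      rw [← eq_intCast (Int.castRingHom ℚ), ← this, ← smul_eq_C_mul, Int.cast_smul_eq_zsmul]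
      exact hbp
    have hc : (r.content : ℚ) ≠ 0 := by exact_mod_cast mt content_eq_zero_iff.mp hr0
    refine ⟨r.primPart, r.isPrimitive_primPart, ?_⟩
    refine (associated_unit_mul_left _ _ (isUnit_C.mpr hb0.isUnit)).symm.trans ?_
    rw [← hr]
    exact associated_unit_mul_left _ _ (isUnit_C.mpr hc.isUnit)
  have h1 : (q * q).map (Int.castRingHom ℚ) ∣ F.map (Int.castRingHom ℚ) := by
    rw [Polynomial.map_mul]
    exact (hpq.mul_mul hpq).symm.dvd.trans hdvd
  have h3 := hF q ((IsPrimitive.Int.dvd_iff_map_cast_dvd_map_cast _ F (hq.mul hq)).mpr h1)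
  exact hp.not_isUnit (hpq.symm.isUnit (h3.map (Polynomial.mapRingHom (Int.castRingHom ℚ))))

/-- A squarefree polynomial divides every polynomial that vanishes at its roots in an
algebraically closed extension. -/
lemma dvd_of_forall_root {k : Type*} [Field k] [CharZero k] (Ω : Type*) [Field Ω] [Algebra k Ω]
    [IsAlgClosed Ω] {F D : k[X]} (hF : Squarefree F)
    (h : ∀ a : Ω, aeval a F = 0 → aeval a (derivative F) ≠ 0 → aeval a D = 0) :
    F ∣ D := by
  by_cases hD : D = 0
  · simp [hD]
  have hsep := PerfectField.separable_iff_squarefree.mpr hF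
  rw [← Polynomial.map_dvd_map' (algebraMap k Ω)]
  rw [IsAlgClosed.dvd_iff_roots_le_roots (by simpa using hF.ne_zero) (by simpa using hD),
    Multiset.le_iff_subset (nodup_roots hsep.map)]
  intro a ha
  rw [mem_roots (by simpa using hF.ne_zero), IsRoot.def, eval_map_algebraMap] at ha
  rw [mem_roots (by simpa using hD), IsRoot.def, eval_map_algebraMap]
  exact h a ha (hsep.aeval_derivative_ne_zero ha)

/-- Taylor expansion at `a`. -/
noncomputable def taylorSeries {k : Type*} [Field k] (a : k) : k[X] →+* PowerSeries k :=
  Polynomial.coeToPowerSeries.ringHom.comp (Polynomial.taylorAlgHom a).toRingHom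

lemma taylorSeries_injective {k : Type*} [Field k] (a : k) :
    Function.Injective (taylorSeries a) :=
  fun _ _ h => Polynomial.taylor_injective a (Polynomial.coe_injective k h)

lemma constantCoeff_taylorSeries {k : Type*} [Field k] (a : k) (f : k[X]) :
    PowerSeries.constantCoeff (taylorSeries a f) = f.eval a := by
  simp [taylorSeries, ← PowerSeries.coeff_zero_eq_constantCoeff_apply]

lemma coeff_one_taylorSeries {k : Type*} [Field k] (a : k) (f : k[X]) :
    PowerSeries.coeff 1 (taylorSeries a f) = f.derivative.eval a := by
  simp [taylorSeries]

/-- At a simple root the expansion is `X` times a unit. -/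
lemma irreducible_taylorSeries {k : Type*} [Field k] {a : k} {f : k[X]} (h₀ : f.eval a = 0)
    (h₁ : f.derivative.eval a ≠ 0) : Irreducible (taylorSeries a f) := by
  obtain ⟨g, hg⟩ := PowerSeries.X_dvd_iff.mpr ((constantCoeff_taylorSeries a f).trans h₀)
  have hu : IsUnit g := by
    rw [PowerSeries.isUnit_iff_constantCoeff, isUnit_iff_ne_zero]
    rwa [← coeff_one_taylorSeries, hg, show 1 = 0 + 1 from rfl, PowerSeries.coeff_succ_X_mul,
      PowerSeries.coeff_zero_eq_constantCoeff_apply] at h₁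
  rw [hg, irreducible_mul_isUnit hu]
  exact PowerSeries.X_irreducible

/-! ### Level structures, and the conclusion. -/

open scoped Classical in
/-- If a Galois automorphism of the base acts as `-1` on the `2`-power torsion of a curve with level
structure for the image of `H ⊇ Γ(2ᵏ)`, then `-1 ∈ H`. -/
lemma neg_one_mem_of_galAct_eq_neg {H : Subgroup (GL (Fin 2) ℤ_[2])} {k : ℕ}
    (hk : (reduction k).ker ≤ H) {K : Type} [Field K] (X : LevelCurve (H.map (reduction k)) K)
    (σ : AlgebraicClosure K ≃ₐ[K] AlgebraicClosure K)
    (hσ : ∀ P ∈ GeomTorsion X.E (2 ^ k), galAct X.E σ P = -P) : -1 ∈ H := by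
  obtain ⟨A, ⟨h, hh, rfl⟩, hA⟩ := X.rational σ
  have hv : ∀ v, v ᵥ* ((reduction k h : GL (Fin 2) (ZMod (2 ^ k))) :
      Matrix (Fin 2) (Fin 2) (ZMod (2 ^ k))) = -v := by
    intro v
    apply X.ι.injective
    apply Subtype.ext
    rw [← hA v, hσ _ (X.ι v).2, map_neg, NegMemClass.coe_neg]
  have hm : reduction k h = -1 := by
    apply Units.ext
    apply Matrix.ext_of_single_vecMul
    intro i
    rw [hv]
    ext j
    simp [Matrix.one_apply, Pi.single_apply, eq_comm]
  -- As `h` reduces to `-1`, the product of `-h ∈ Γ(2ᵏ) ⊆ H` with `h⁻¹ ∈ H` is `-1`.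
  have hker : -h ∈ (reduction k).ker := by
    rw [MonoidHom.mem_ker]
    have : reduction k (-h) = - reduction k h := by
      apply Units.ext
      ext i j
      simp [reduction]
    rw [this, hm, neg_neg]
  have := H.mul_mem (hk hker) (H.inv_mem hh)
  simpa using this

/-- The embedding of `ℚ(t)` into the field of Laurent series in `t - a`. -/
noncomputable def ratFuncToSeries (a : AlgebraicClosure ℚ) :
    RatFunc ℚ →+* FractionRing (PowerSeries (AlgebraicClosure ℚ)) :=
  IsFractionRing.lift (A := ℚ[X])
    (g := (algebraMap (PowerSeries (AlgebraicClosure ℚ)) _).comp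
      ((taylorSeries a).comp (Polynomial.mapRingHom (algebraMap ℚ (AlgebraicClosure ℚ)))))
    ((IsFractionRing.injective _ _).comp
      ((taylorSeries_injective a).comp (Polynomial.map_injective _ (algebraMap ℚ _).injective)))

lemma ratFuncToSeries_toRatFunc (a : AlgebraicClosure ℚ) (f : ℤ[X]) :
    ratFuncToSeries a (toRatFunc f) = algebraMap _ _
      (taylorSeries a ((f.map (Int.castRingHom ℚ)).map (algebraMap ℚ (AlgebraicClosure ℚ)))) :=
  IsFractionRing.lift_algebraMap _ _

end ModularTwist

theorem theorem5p4 (H : Subgroup (GL (Fin 2) ℤ_[2])) (hH : (-1 : GL (Fin 2) ℤ_[2]) ∉ H)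
    (EH : WeierstrassCurve (RatFunc ℚ)) (hEH : ModularTwist.IsUniversalCurve H EH)
    (A B F : ℤ[X]) (hF : Squarefree F)
    (hiso : ∃ C : WeierstrassCurve.VariableChange (RatFunc ℚ),
      C • EH = (ModularTwist.shortTwist A B F).map ModularTwist.toRatFunc) :
    F.map (Int.castRingHom ℚ) ∣ (ModularTwist.shortCurve A B).Δ.map (Int.castRingHom ℚ) := by
  classical
  obtain ⟨k, hk, X, rfl, -, -⟩ := hEH
  obtain ⟨C, hC⟩ := hiso
  refine ModularTwist.dvd_of_forall_root (AlgebraicClosure ℚ)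
    (ModularTwist.squarefree_map_int_cast hF) fun a h₀ h₁ => ?_
  by_contra hΔ
  have hC' : C • X.E = ModularTwist.shortTwist (ModularTwist.toRatFunc A)
      (ModularTwist.toRatFunc B) (ModularTwist.toRatFunc F) := by
    rw [hC]
    simp [ModularTwist.shortTwist, ModularTwist.shortCurve, WeierstrassCurve.map]
  obtain ⟨σ, hσ⟩ := ModularTwist.exists_galAct_eq_neg (ModularTwist.ratFuncToSeries a) hC'
    (ModularTwist.ratFuncToSeries_toRatFunc a A) (ModularTwist.ratFuncToSeries_toRatFunc a B)
    (ModularTwist.ratFuncToSeries_toRatFunc a F)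
    (by
      rw [PowerSeries.isUnit_iff_constantCoeff, isUnit_iff_ne_zero]
      simp only [map_add, map_mul, map_pow, map_ofNat, ModularTwist.constantCoeff_taylorSeries]
      contrapose! hΔ
      simp only [ModularTwist.shortCurve, WeierstrassCurve.Δ, WeierstrassCurve.b₂,
        WeierstrassCurve.b₄, WeierstrassCurve.b₆, WeierstrassCurve.b₈, eval_map_algebraMap] at hΔ ⊢
      simp [-eq_intCast] at hΔ ⊢
      simp only [map_ofNat]
      linear_combination (-16) * hΔ)
    (ModularTwist.irreducible_taylorSeries (by rwa [eval_map_algebraMap])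
      (by rwa [derivative_map, eval_map_algebraMap]))
  exact hH (ModularTwist.neg_one_mem_of_galAct_eq_neg hk X σ fun P hP => hσ k P (by
    have : ((2 ^ k : ℕ) : ℤ) • P = 0 := hP
    rwa [natCast_zsmul] at this))
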